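/- Let $n\ge 0$. For a partition (Young diagram) $\alpha$ of $n$, with rows $\alpha_1\ge\alpha_2\ge\dots$, let $[\alpha]$ be the irreducible representation of $S_n$ given by left multiplication on the left ideal $\mathbb{R}[S_n]\,c_\alpha$. Here $c_\alpha=\big(\sum_{h\in H}h\big)\big(\sum_{v\in V}\operatorname{sign}(v)\,v\big)$ is the Young symmetrizer, and $H$ and $V$ are the row and column stabilizers of the filling of $\alpha$ by $1,\dots,n$ in reading order. For an $n\times n$ matrix $A=(a_{i,j})$ with non-negative entries (a weighted graph on $\{1,\dots,n\}$), put $\Delta_A=\sum_{i<j}a_{i,j}(\mathrm{id}-(i\,j))\in\mathbb{R}[S_n]$, $\mathrm{wt}(A)=\sum_{i<j}a_{i,j}$, and let $\lambda_1(A;\alpha)$ be the smallest eigenvalue of $\Delta_A$ acting on $[\alpha]$. The Aldous order is defined by $\alpha\preceq\beta$ if and only if $\lambda_1(A;\alpha)\ge\lambda_1(A;\beta)$ for all such $A$. Write $\alpha\succ\beta$ if $\beta\preceq\alpha$ and $\alpha\neq\beta$. Lexicographic order is taken on the sequences of row lengths. Let $G=\sum_{k=2}^n a_k\,\mathrm{Str}_{n,k}$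 be the quasi-complete graph with weights $a_k=n^{-2k}$, where $\mathrm{Str}_{n,k}$ is the star joining the vertex $k$ to each of $1,\dots,k-1$. For a sequence of Young diagrams $\alpha=\alpha^{(n)},\alpha^{(n-1)},\dots,\alpha^{(0)}=\emptyset$, in which $\alpha^{(k-1)}$ is obtained from $\alpha^{(k)}$ by removing the $x_k$-th box of the $y_k$-th row, consider the number $$\mathrm{wt}(G)-\sum_{k=2}^n a_k(x_k-y_k).\qquad(*)$$ Then the following hold. 1. For every partition $\alpha$ of $n$, among all such sequences, the number $(*)$ is minimal for the sequence that first removes the lowest row completely, then the second lowest row completely, and so on; this minimal value is the smallest eigenvalue $\lambda_1(G;\alpha)$. 2. If $\alpha<\beta$ in the lexicographic order, then $\lambda_1(G;\alpha)>\lambda_1(G;\beta)$. 3. If $\alpha<\beta$ in the lexicographic order, then $\alpha\nsucc\beta$. 4. If $\alpha\preceq\beta$ and $\beta\preceq\alpha$, then $\alpha=\beta$; that is, $\preceq$ is antisymmetric. -/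

import Mathlib

/-- Young diagrams with `n` boxes (equivalently, partitions of `n`).  A box is a pair
`(row, column)`, both counted from `0`; rows are listed from top to bottom. -/
abbrev Diagram (n : ℕ) : Type := {μ : YoungDiagram // μ.card = n}

namespace Diagram

/-- `α < β` lexicographically: at the first row where they differ, the row of `α` is shorter. -/
def LexLT {n : ℕ} (α β : Diagram n) : Prop :=
  toLex α.1.rowLen < toLex β.1.rowLen

/-- The number of boxes of `α` in the rows strictly above row `r`. -/
def rowStart {n : ℕ} (α : Diagram n) (r : ℕ) : ℕ :=
  ∑ s ∈ Finset.range r, α.1.rowLen s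

/-- Write `0, 1, …, n - 1` into the boxes of `α`, row after row and from left to right.
This is the row that contains the entry `i`. -/
noncomputable def rowIdx {n : ℕ} (α : Diagram n) (i : Fin n) : ℕ :=
  sInf {r : ℕ | (i : ℕ) < α.rowStart (r + 1)}

/-- The column that contains the entry `i` in the same filling. -/
noncomputable def colIdx {n : ℕ} (α : Diagram n) (i : Fin n) : ℕ :=
  (i : ℕ) - α.rowStart (α.rowIdx i)

/-- The sum of all permutations that preserve the rows of `α`. -/
noncomputable def rowSum {n : ℕ} (α : Diagram n) : MonoidAlgebra ℝ (Equiv.Perm (Fin n)) :=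
  ∑ h : Equiv.Perm (Fin n) with ∀ i, α.rowIdx (h i) = α.rowIdx i, MonoidAlgebra.single h 1

/-- The signed sum of all permutations that preserve the columns of `α`. -/
noncomputable def colSum {n : ℕ} (α : Diagram n) : MonoidAlgebra ℝ (Equiv.Perm (Fin n)) :=
  ∑ v : Equiv.Perm (Fin n) with ∀ i, α.colIdx (v i) = α.colIdx i,
    MonoidAlgebra.single v (((Equiv.Perm.sign v : ℤ) : ℝ))

/-- The Young symmetrizer of `α`. -/
noncomputable def youngSymmetrizer {n : ℕ} (α : Diagram n) :
    MonoidAlgebra ℝ (Equiv.Perm (Fin n)) :=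
  α.rowSum * α.colSum

/-- The left ideal of the group ring `ℝ[Sₙ]` generated by the Young symmetrizer. -/
noncomputable def spechtIdeal {n : ℕ} (α : Diagram n) :
    Submodule (MonoidAlgebra ℝ (Equiv.Perm (Fin n))) (MonoidAlgebra ℝ (Equiv.Perm (Fin n))) :=
  Submodule.span (MonoidAlgebra ℝ (Equiv.Perm (Fin n))) {α.youngSymmetrizer}

/-- The irreducible representation `[α]` of `Sₙ`: left multiplication on the left ideal generated
by the Young symmetrizer. -/
noncomputable def irrep {n : ℕ} (α : Diagram n) :
    Representation ℝ (Equiv.Perm (Fin n)) α.spechtIdeal :=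
  Representation.ofModule' α.spechtIdeal

end Diagram

/-- `Δ_A = ∑_{i < j} a_{ij} (id - (i j))` in the group ring `ℝ[Sₙ]`. -/
noncomputable def laplacian {n : ℕ} (A : Matrix (Fin n) (Fin n) ℝ) :
    MonoidAlgebra ℝ (Equiv.Perm (Fin n)) :=
  ∑ i : Fin n, ∑ j : Fin n with i < j,
    A i j • (MonoidAlgebra.single 1 1 - MonoidAlgebra.single (Equiv.swap i j) 1)

/-- The set of eigenvalues of `ρ(Δ_A)`. -/
def eigenvalueSet {n : ℕ} {V : Type*} [AddCommGroup V] [Module ℝ V]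
    (A : Matrix (Fin n) (Fin n) ℝ) (ρ : Representation ℝ (Equiv.Perm (Fin n)) V) : Set ℝ :=
  {μ : ℝ | Module.End.HasEigenvalue (ρ.asAlgebraHom (laplacian A)) μ}

/-- The smallest eigenvalue `λ₁(A; ρ)` of `ρ(Δ_A)`. -/
noncomputable def lambda1 {n : ℕ} {V : Type*} [AddCommGroup V] [Module ℝ V]
    (A : Matrix (Fin n) (Fin n) ℝ) (ρ : Representation ℝ (Equiv.Perm (Fin n)) V) : ℝ :=
  sInf (eigenvalueSet A ρ)

/-- `ρ ⪯ σ` in the Aldous order: `λ₁(A; ρ) ≥ λ₁(A; σ)` for every matrix `A` with non-negative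
entries. -/
def AldousLE {n : ℕ} {V W : Type*} [AddCommGroup V] [Module ℝ V] [AddCommGroup W] [Module ℝ W]
    (ρ : Representation ℝ (Equiv.Perm (Fin n)) V)
    (σ : Representation ℝ (Equiv.Perm (Fin n)) W) : Prop :=
  ∀ A : Matrix (Fin n) (Fin n) ℝ, (∀ i j, 0 ≤ A i j) → lambda1 A σ ≤ lambda1 A ρ

namespace Diagram

/-- `α ⪯ β`: the Aldous order on the irreducible representations `[α]` and `[β]`. -/
def AldousLE {n : ℕ} (α β : Diagram n) : Prop := _root_.AldousLE α.irrep β.irrep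

/-- `α ≺ β`, that is, `β ≻ α`: the strict Aldous order. -/
def AldousLT {n : ℕ} (α β : Diagram n) : Prop := α.AldousLE β ∧ α ≠ β

end Diagram

/-- The adjacency matrix of the complete graph on the first `k` of the `n` vertices. -/
def completeOn (n k : ℕ) : Matrix (Fin n) (Fin n) ℝ :=
  fun i j => if i ≠ j ∧ (i : ℕ) < k ∧ (j : ℕ) < k then 1 else 0

/-- The star whose centre is the `k`-th vertex and whose leaves are the first `k - 1` vertices. -/
def starGraph (n k : ℕ) : Matrix (Fin n) (Fin n) ℝ := completeOn n k - completeOn n (k - 1)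

/-- The quasi-complete graph on `n` vertices with weights `a 2, …, a n`. -/
def quasiComplete (n : ℕ) (a : ℕ → ℝ) : Matrix (Fin n) (Fin n) ℝ :=
  ∑ k ∈ Finset.Icc 2 n, a k • starGraph n k

/-- The total weight `∑_{i < j} a_{ij}`. -/
def totalWeight {n : ℕ} (A : Matrix (Fin n) (Fin n) ℝ) : ℝ :=
  ∑ i : Fin n, ∑ j : Fin n with i < j, A i j

/-- The weights `a_k = n^{-2k}`. -/
noncomputable def fastWeights (n : ℕ) (k : ℕ) : ℝ := ((n : ℝ) ^ (2 * k))⁻¹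

/-- A way to take `α` apart box by box: `diag k` has `k` boxes, `diag n = α`, and `diag k` is
obtained from `diag (k + 1)` by removing the box `box (k + 1)`. -/
structure RemovalSequence {n : ℕ} (α : Diagram n) where
  diag : ℕ → YoungDiagram
  box : ℕ → ℕ × ℕ
  diag_zero : diag 0 = ⊥
  diag_last : diag n = α.1
  box_notMem : ∀ k < n, box (k + 1) ∉ (diag k).cells
  cells_succ : ∀ k < n, (diag (k + 1)).cells = insert (box (k + 1)) (diag k).cells

namespace RemovalSequence

/-- The lowest row is removed completely first, then the second lowest row, and so on.  (Boxes are
removed in the order `box n, box (n - 1), …, box 1`.) -/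
def IsRowByRow {n : ℕ} {α : Diagram n} (S : RemovalSequence α) : Prop :=
  ∀ k l : ℕ, 1 ≤ k → k ≤ l → l ≤ n → (S.box k).1 ≤ (S.box l).1

/-- The eigenvalue `wt(G) - ∑_k a_k (x_k - y_k)` of the quasi-complete graph with weights `a`
attached to the sequence, where `box k` is the `x_k`-th box of row `y_k`. -/
def eigenvalue {n : ℕ} {α : Diagram n} (S : RemovalSequence α) (a : ℕ → ℝ) : ℝ :=
  totalWeight (quasiComplete n a) -
    ∑ k ∈ Finset.Icc 2 n, a k * (((S.box k).2 : ℝ) - ((S.box k).1 : ℝ))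

end RemovalSequence

/-! Left multiplication by the Laplacian of the quasi-complete graph is wt(G) minus the weighted sum
of the commuting Jucys–Murphy elements J_k = ∑_{i<k} (i k), so the claim concerns the largest
eigenvalue of ∑ a_k J_k on the ideal. The weights decay so fast that ∑ a_k x_k, with |x_k| ≤ k - 1,
is ordered lexicographically once a first difference is at least 1 (`sum_fastWeights_lt`).

Coefficient functions of elements of the ideal alternate under right multiplication by column
transpositions. If such a function is also invariant under left multiplication by row
transpositions, a pigeonhole argument (`ColAlternating.eq_zero`) makes it a joint eigenvector of all
J_k, the eigenvalues being the contents of the boxes in reading order. The Young symmetrizer is such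
a function, so the row-by-row value is attained.

For the bound, an eigenvector of ∑ a_k J_k is symmetrized along the rows, one entry at a time
(`exists_rowInvariant_or_lt`). Each symmetrization acts as J_k plus a constant, hence preserves the
eigenvalue. If none vanishes, the eigenvalue is the content sum. If the one for k vanishes, J_k acts
by less than the content while the earlier J_j act by the contents, and the eigenvalue is strictly
smaller.

Other removal sequences, and lexicographically smaller partitions, also have smaller content at the
first place where the contents differ. This gives minimality and strict monotonicity; antisymmetry
follows because the lexicographic order is total. -/

namespace Diagram

/-! ### Reading order of a diagram -/

/-- The row of the `i`-th box of `α` in reading order. -/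
noncomputable def rowOf {n : ℕ} (α : Diagram n) (i : ℕ) : ℕ :=
  sInf {r : ℕ | i < α.rowStart (r + 1)}

/-- The column of the `i`-th box of `α` in reading order. -/
noncomputable def colOf {n : ℕ} (α : Diagram n) (i : ℕ) : ℕ :=
  i - α.rowStart (α.rowOf i)

variable {n : ℕ} (α : Diagram n)

theorem rowIdx_eq_rowOf (i : Fin n) : α.rowIdx i = α.rowOf i := rfl

theorem colIdx_eq_colOf (i : Fin n) : α.colIdx i = α.colOf i := rfl

theorem rowStart_succ (r : ℕ) : α.rowStart (r + 1) = α.rowStart r + α.1.rowLen r :=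
  Finset.sum_range_succ _ _

theorem rowStart_mono : Monotone α.rowStart :=
  monotone_nat_of_le_succ fun r => by rw [rowStart_succ]; exact Nat.le_add_right _ _

theorem rowStart_eq_card (r : ℕ) : α.rowStart r = (α.1.cells.filter (·.1 < r)).card := by
  induction r with
  | zero => simp [rowStart]
  | succ r ih =>
    rw [rowStart_succ, ih, YoungDiagram.rowLen_eq_card, YoungDiagram.row,
      ← Finset.card_union_of_disjoint]
    · congr 1
      ext c
      simp only [Finset.mem_union, Finset.mem_filter, YoungDiagram.mem_cells]
      constructor
      · rintro (⟨h, h'⟩ | ⟨h, h'⟩)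
        · exact ⟨h, by omega⟩
        · exact ⟨h, by omega⟩
      · rintro ⟨h, h'⟩
        rcases Nat.lt_succ_iff_lt_or_eq.1 h' with h'' | h''
        · exact Or.inl ⟨h, h''⟩
        · exact Or.inr ⟨h, h''⟩
    · rw [Finset.disjoint_left]
      intro c h h'
      have := (Finset.mem_filter.1 h).2
      have := (Finset.mem_filter.1 h').2
      omega

theorem rowStart_le (r : ℕ) : α.rowStart r ≤ n := by
  rw [rowStart_eq_card]
  exact (Finset.card_filter_le _ _).trans α.2.le

theorem exists_rowStart_eq : ∃ r, α.rowStart r = n := by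
  refine ⟨α.1.cells.sup Prod.fst + 1, ?_⟩
  rw [rowStart_eq_card, Finset.filter_true_of_mem]
  · exact α.2
  · intro c hc
    exact Nat.lt_succ_of_le (Finset.le_sup (f := Prod.fst) hc)

theorem lt_rowStart_rowOf_succ {i : ℕ} (hi : i < n) : i < α.rowStart (α.rowOf i + 1) := by
  obtain ⟨r, hr⟩ := α.exists_rowStart_eq
  refine Nat.sInf_mem (s := {r : ℕ | i < α.rowStart (r + 1)}) ⟨r, ?_⟩
  exact (hi.trans_eq hr.symm).trans_le (α.rowStart_mono (Nat.le_succ r))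

theorem rowStart_rowOf_le (i : ℕ) : α.rowStart (α.rowOf i) ≤ i := by
  rcases h : α.rowOf i with _ | r
  · simp [rowStart]
  · by_contra! hlt
    have : α.rowOf i ≤ r := Nat.sInf_le hlt
    omega

theorem rowOf_eq {r i : ℕ} (h₁ : α.rowStart r ≤ i) (h₂ : i < α.rowStart (r + 1)) :
    α.rowOf i = r := by
  apply le_antisymm
  · exact Nat.sInf_le h₂
  · by_contra! hlt
    have h := α.lt_rowStart_rowOf_succ (h₂.trans_le (α.rowStart_le _))
    exact absurd (h.trans_le (α.rowStart_mono hlt)) (not_lt.2 h₁)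

theorem rowStart_add_colOf (i : ℕ) : α.rowStart (α.rowOf i) + α.colOf i = i :=
  Nat.add_sub_cancel' (α.rowStart_rowOf_le i)

theorem rowOf_colOf_mem {i : ℕ} (hi : i < n) : (α.rowOf i, α.colOf i) ∈ α.1 := by
  rw [YoungDiagram.mem_iff_lt_rowLen]
  have h := α.lt_rowStart_rowOf_succ hi
  have := α.rowStart_add_colOf i
  rw [rowStart_succ] at h
  omega

theorem rowOf_rowStart_add {r c : ℕ} (h : (r, c) ∈ α.1) : α.rowOf (α.rowStart r + c) = r := by
  rw [YoungDiagram.mem_iff_lt_rowLen] at h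
  exact α.rowOf_eq (Nat.le_add_right _ _) (by rw [rowStart_succ]; omega)

theorem colOf_rowStart_add {r c : ℕ} (h : (r, c) ∈ α.1) : α.colOf (α.rowStart r + c) = c := by
  rw [colOf, rowOf_rowStart_add α h]
  omega

theorem rowStart_add_lt {r c : ℕ} (h : (r, c) ∈ α.1) : α.rowStart r + c < n := by
  rw [YoungDiagram.mem_iff_lt_rowLen] at h
  have := α.rowStart_le (r + 1)
  rw [rowStart_succ] at this
  omega

theorem rowOf_mono {i j : ℕ} (hij : i ≤ j) (hj : j < n) : α.rowOf i ≤ α.rowOf j :=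
  Nat.sInf_le (hij.trans_lt (α.lt_rowStart_rowOf_succ hj))

theorem eq_of_rowOf_eq_of_colOf_eq {i j : ℕ} (hr : α.rowOf i = α.rowOf j)
    (hc : α.colOf i = α.colOf j) : i = j := by
  rw [← α.rowStart_add_colOf i, ← α.rowStart_add_colOf j, hr, hc]

theorem rowLen_injective {α β : Diagram n} (h : α.1.rowLen = β.1.rowLen) : α = β := by
  apply Subtype.ext
  apply YoungDiagram.ext
  ext ⟨r, c⟩
  simp only [YoungDiagram.mem_cells, YoungDiagram.mem_iff_lt_rowLen, h]

/-- The boxes of `α` that come before position `k` in reading order. -/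
noncomputable def initialDiagram (k : ℕ) : YoungDiagram where
  cells := α.1.cells.filter fun c => α.rowStart c.1 + c.2 < k
  isLowerSet := by
    rintro ⟨r, c⟩ ⟨r', c'⟩ ⟨hr, hc⟩ h
    simp only [Finset.coe_filter, Set.mem_ofPred_eq, YoungDiagram.mem_cells] at h ⊢
    exact ⟨α.1.up_left_mem hr hc h.1,
      (add_le_add (α.rowStart_mono hr) hc).trans_lt h.2⟩

theorem mem_initialDiagram {k : ℕ} {c : ℕ × ℕ} :
    c ∈ (α.initialDiagram k).cells ↔ c ∈ α.1 ∧ α.rowStart c.1 + c.2 < k := by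
  simp [initialDiagram]

/-- The removal sequence that removes the boxes of `α` in reverse reading order. -/
noncomputable def rowByRow : RemovalSequence α where
  diag := α.initialDiagram
  box k := (α.rowOf (k - 1), α.colOf (k - 1))
  diag_zero := by
    apply YoungDiagram.ext
    ext c
    simp only [mem_initialDiagram]
    simp
  diag_last := by
    apply YoungDiagram.ext
    ext ⟨r, c⟩
    rw [mem_initialDiagram]
    exact ⟨fun h => h.1, fun h => ⟨h, α.rowStart_add_lt h⟩⟩
  box_notMem k _ := by
    rw [mem_initialDiagram]
    simp [rowStart_add_colOf]
  cells_succ k hk := by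
    ext ⟨r, c⟩
    simp only [Finset.mem_insert, mem_initialDiagram, Nat.add_sub_cancel]
    constructor
    · rintro ⟨h, h'⟩
      rcases Nat.lt_succ_iff_lt_or_eq.1 h' with h'' | h''
      · exact Or.inr ⟨h, h''⟩
      · left
        rw [← h'', rowOf_rowStart_add α h, colOf_rowStart_add α h]
    · rintro (h | ⟨h, h'⟩)
      · obtain ⟨rfl, rfl⟩ := Prod.mk.inj h
        refine ⟨α.rowOf_colOf_mem hk, ?_⟩
        rw [rowStart_add_colOf]
        omega
      · exact ⟨h, by omega⟩

theorem rowByRow_isRowByRow : α.rowByRow.IsRowByRow := fun k l hk hkl hl =>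
  α.rowOf_mono (by omega) (by omega)

/-- The content of the `i`-th box of `α` in reading order. -/
noncomputable def content (i : ℕ) : ℝ := α.colOf i - α.rowOf i

end Diagram

/-! ### Contents along removal sequences -/

namespace RemovalSequence

variable {n : ℕ} {α : Diagram n} (S : RemovalSequence α)

theorem cells_eq_image {k : ℕ} (hk : k ≤ n) :
    (S.diag k).cells = (Finset.range k).image fun j => S.box (j + 1) := by
  induction k with
  | zero => simp [S.diag_zero]
  | succ k ih =>
    rw [S.cells_succ k (by omega), ih (by omega), Finset.range_add_one, Finset.image_insert]

theorem box_mem_diag {k : ℕ} (hk : k < n) : S.box (k + 1) ∈ S.diag (k + 1) := by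
  rw [← YoungDiagram.mem_cells, S.cells_succ k hk]
  exact Finset.mem_insert_self _ _

theorem box_mem {k : ℕ} (hk : k < n) : S.box (k + 1) ∈ α.1 := by
  rw [← S.diag_last, ← YoungDiagram.mem_cells, S.cells_eq_image le_rfl]
  exact Finset.mem_image_of_mem (fun j => S.box (j + 1)) (Finset.mem_range.2 hk)

theorem card_diag_le {k : ℕ} (hk : k ≤ n) : (S.diag k).cells.card ≤ k := by
  rw [S.cells_eq_image hk]
  exact Finset.card_image_le.trans (Finset.card_range k).le

/-- The boxes above the new one in its column all lie in a diagram with at most `k + 1` boxes. -/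
theorem box_fst_le {k : ℕ} (hk : k < n) : (S.box (k + 1)).1 ≤ k := by
  have h : (Finset.range ((S.box (k + 1)).1 + 1)).card ≤ (S.diag (k + 1)).cells.card := by
    refine Finset.card_le_card_of_injOn (fun r => (r, (S.box (k + 1)).2)) ?_ ?_
    · intro r hr
      exact (S.diag (k + 1)).up_left_mem (Nat.lt_succ_iff.1 (Finset.mem_range.1 hr)) le_rfl
        (S.box_mem_diag hk)
    · intro a _ b _ h
      exact (Prod.ext_iff.1 h).1
  have := S.card_diag_le (k := k + 1) (by omega)
  rw [Finset.card_range] at h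
  omega

theorem box_snd_le {k : ℕ} (hk : k < n) : (S.box (k + 1)).2 ≤ k := by
  have h : (Finset.range ((S.box (k + 1)).2 + 1)).card ≤ (S.diag (k + 1)).cells.card := by
    refine Finset.card_le_card_of_injOn (fun c => ((S.box (k + 1)).1, c)) ?_ ?_
    · intro c hc
      exact (S.diag (k + 1)).up_left_mem le_rfl (Nat.lt_succ_iff.1 (Finset.mem_range.1 hc))
        (S.box_mem_diag hk)
    · intro a _ b _ h
      exact (Prod.ext_iff.1 h).2
  have := S.card_diag_le (k := k + 1) (by omega)
  rw [Finset.card_range] at h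
  omega

theorem abs_content_box_le {k : ℕ} (hk : k < n) :
    |((S.box (k + 1)).2 : ℝ) - ((S.box (k + 1)).1 : ℝ)| ≤ k := by
  have h₁ : ((S.box (k + 1)).1 : ℝ) ≤ k := by exact_mod_cast S.box_fst_le hk
  have h₂ : ((S.box (k + 1)).2 : ℝ) ≤ k := by exact_mod_cast S.box_snd_le hk
  have h₃ : (0 : ℝ) ≤ (S.box (k + 1)).1 := Nat.cast_nonneg _
  have h₄ : (0 : ℝ) ≤ (S.box (k + 1)).2 := Nat.cast_nonneg _
  rw [abs_le]
  constructor <;> linarith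

/-- At the first place where a removal sequence deviates from the reading order, its box has
smaller content. -/
theorem content_box_lt_of_forall_eq {k : ℕ} (hk : k < n)
    (h : ∀ j < k, S.box (j + 1) = (α.rowOf j, α.colOf j))
    (hne : S.box (k + 1) ≠ (α.rowOf k, α.colOf k)) :
    ((S.box (k + 1)).2 : ℝ) - ((S.box (k + 1)).1 : ℝ) + 1 ≤ α.content k := by
  rcases hb : S.box (k + 1) with ⟨r, c⟩
  have hmem : (r, c) ∈ α.1 := hb ▸ S.box_mem hk
  have hdiag : ∀ j, (α.rowOf j, α.colOf j) ∈ (S.diag k).cells → j < k := by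
    intro j hj
    rw [S.cells_eq_image hk.le, Finset.mem_image] at hj
    obtain ⟨i, hi, hij⟩ := hj
    rw [Finset.mem_range] at hi
    rw [h i hi, Prod.ext_iff] at hij
    rw [← α.eq_of_rowOf_eq_of_colOf_eq hij.1 hij.2]
    exact hi
  -- A new box weakly below and to the right of the `k`-th box would force that box to be present
  -- already.
  have hnot : ¬ (α.rowOf k ≤ r ∧ α.colOf k ≤ c) := by
    rintro ⟨h₁, h₂⟩
    have h₃ := (S.diag (k + 1)).up_left_mem h₁ h₂ (hb ▸ S.box_mem_diag hk)
    rw [← YoungDiagram.mem_cells, S.cells_succ k hk, Finset.mem_insert] at h₃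
    rcases h₃ with h₃ | h₃
    · exact hne h₃.symm
    · exact lt_irrefl _ (hdiag k h₃)
  -- The first `k` boxes in reading order are used up, so the new box comes later and cannot lie in
  -- a higher row.
  have hkj : k ≤ α.rowStart r + c := by
    by_contra! hlt
    refine S.box_notMem k hk ?_
    rw [S.cells_eq_image hk.le, Finset.mem_image]
    refine ⟨α.rowStart r + c, Finset.mem_range.2 hlt, ?_⟩
    rw [h _ hlt, α.rowOf_rowStart_add hmem, α.colOf_rowStart_add hmem, hb]
  have hr : α.rowOf k ≤ r := by
    have := α.rowOf_mono hkj (α.rowStart_add_lt hmem)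
    rwa [α.rowOf_rowStart_add hmem] at this
  have hc : c + 1 ≤ α.colOf k := by
    by_contra! hlt
    exact hnot ⟨hr, by omega⟩
  have hr' : (α.rowOf k : ℝ) ≤ r := by exact_mod_cast hr
  have hc' : (c : ℝ) + 1 ≤ α.colOf k := by exact_mod_cast hc
  simp only [Diagram.content]
  linarith

end RemovalSequence

/-! ### Lexicographic order and contents -/

namespace Diagram

theorem abs_content_le {n : ℕ} (α : Diagram n) {k : ℕ} (hk : k < n) : |α.content k| ≤ k :=
  α.rowByRow.abs_content_box_le hk

/-- Let `r` be the first row that differs. At the position just after row `r` of `α` ends, `β`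
continues row `r`, while `α` must start a lower row in column 0; before it the two fillings agree.
-/
theorem LexLT.exists_content_lt {n : ℕ} {α β : Diagram n} (h : α.LexLT β) :
    ∃ k < n, (∀ j < k, α.content j = β.content j) ∧ α.content k + 1 ≤ β.content k := by
  obtain ⟨r, heq, hlt⟩ := h
  simp only [Pi.toLex_apply] at heq hlt
  have hs : ∀ t ≤ r, α.rowStart t = β.rowStart t := fun t ht =>
    Finset.sum_congr rfl fun s hs => heq s ((Finset.mem_range.1 hs).trans_le ht)
  have hβ : (r, α.1.rowLen r) ∈ β.1 := YoungDiagram.mem_iff_lt_rowLen.2 hlt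
  have hkn : α.rowStart r + α.1.rowLen r < n := hs r le_rfl ▸ β.rowStart_add_lt hβ
  refine ⟨α.rowStart r + α.1.rowLen r, hkn, ?_, ?_⟩
  · intro j hj
    have hjn := hj.trans hkn
    have h₁ := α.lt_rowStart_rowOf_succ hjn
    have h₂ := α.rowStart_rowOf_le j
    have hle : α.rowOf j ≤ r := by
      by_contra! hgt
      have := α.rowStart_mono (Nat.succ_le_of_lt hgt)
      rw [Nat.succ_eq_add_one, rowStart_succ] at this
      omega
    have hrow : β.rowOf j = α.rowOf j := by
      apply β.rowOf_eq
      · rwa [← hs _ hle]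
      · rcases hle.lt_or_eq with hlt' | heq'
        · rwa [← hs _ hlt']
        · rw [heq', rowStart_succ, ← hs r le_rfl]
          omega
    have hcol : β.colOf j = α.colOf j := by
      rw [colOf, colOf, hrow, hs _ hle]
    rw [content, content, hrow, hcol]
  · have hb₁ := β.rowOf_rowStart_add hβ
    have hb₂ := β.colOf_rowStart_add hβ
    rw [← hs r le_rfl] at hb₁ hb₂
    have hr : r < α.rowOf (α.rowStart r + α.1.rowLen r) := by
      by_contra! hle
      have := α.lt_rowStart_rowOf_succ hkn
      have h' := α.rowStart_mono (Nat.succ_le_succ hle)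
      rw [Nat.succ_eq_add_one, Nat.succ_eq_add_one, α.rowStart_succ r] at h'
      omega
    have hc : α.colOf (α.rowStart r + α.1.rowLen r) = 0 := by
      have h' := α.rowStart_mono (Nat.succ_le_of_lt hr)
      rw [Nat.succ_eq_add_one, α.rowStart_succ r] at h'
      have := α.rowStart_add_colOf (α.rowStart r + α.1.rowLen r)
      omega
    have hr' : (r : ℝ) + 1 ≤ α.rowOf (α.rowStart r + α.1.rowLen r) := by exact_mod_cast hr
    have : (0 : ℝ) ≤ α.1.rowLen r := Nat.cast_nonneg _
    simp only [content, hb₁, hb₂, hc]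
    push_cast
    linarith

end Diagram

/-- Lexicographic domination of bounded sequences is detected by the weights `n^{-2k}`. -/
theorem sum_fastWeights_lt {n k : ℕ} {x y : ℕ → ℝ} (hk : k < n) (hx : ∀ j < n, |x j| ≤ j)
    (hy : ∀ j < n, |y j| ≤ j) (heq : ∀ j < k, x j = y j) (hlt : x k + 1 ≤ y k) :
    ∑ j ∈ Finset.range n, fastWeights n (j + 1) * x j <
      ∑ j ∈ Finset.range n, fastWeights n (j + 1) * y j := by
  -- The bounds force `x 0 = y 0 = 0`, so the first difference cannot occur at 0.
  have hk0 : 0 < k := by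
    rcases Nat.eq_zero_or_pos k with rfl | h
    · have h₁ := abs_le.1 (hx 0 hk)
      have h₂ := abs_le.1 (hy 0 hk)
      simp only [Nat.cast_zero] at h₁ h₂
      linarith [h₁.1, h₂.2]
    · exact h
  have hn : (2 : ℝ) ≤ n := by exact_mod_cast (show 2 ≤ n by omega)
  have hpos : ∀ j, 0 < fastWeights n j := fun j => by
    unfold fastWeights
    positivity
  have hstep : ∀ j, fastWeights n j = fastWeights n (j + 1) * (n : ℝ) ^ 2 := fun j => by
    unfold fastWeights
    field_simp
    ring
  -- The surplus after `m` terms stays at least the last weight a_m. The next term costs at most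
  -- 2m·a_{m+1}, and a_m = n²·a_{m+1} with 2m + 1 ≤ (m + 1)² ≤ n².
  have key : ∀ m, k < m → m ≤ n →
      ∑ j ∈ Finset.range m, fastWeights n (j + 1) * x j + fastWeights n m ≤
        ∑ j ∈ Finset.range m, fastWeights n (j + 1) * y j := by
    intro m hkm
    induction m, hkm using Nat.le_induction with
    | base =>
      intro _
      rw [Nat.succ_eq_add_one, Finset.sum_range_succ, Finset.sum_range_succ,
        Finset.sum_congr rfl fun j hj => by rw [heq j (Finset.mem_range.1 hj)]]
      nlinarith [hpos (k + 1)]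
    | succ m hkm ih =>
      intro hm
      rw [Finset.sum_range_succ, Finset.sum_range_succ]
      have h₁ := ih (by omega)
      have h₂ := (abs_le.1 (hx m (by omega))).2
      have h₃ := (abs_le.1 (hy m (by omega))).1
      have h₄ : (m : ℝ) + 1 ≤ n := by exact_mod_cast hm
      have h₅ := hstep m
      have h₆ : fastWeights n (m + 1) * (x m + 1 - y m) ≤
          fastWeights n (m + 1) * (n : ℝ) ^ 2 :=
        mul_le_mul_of_nonneg_left (by nlinarith) (hpos _).le
      linarith
  linarith [key n hk le_rfl, hpos n]

/-! ### Jucys–Murphy elements acting on functions on the group -/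

open Equiv (swap)

section SwapSum

variable {n : ℕ}

/-- Left multiplication by `∑_{i ∈ B} (i k)` on the coefficients of elements of the group ring. -/
def swapSum (B : Finset (Fin n)) (k : Fin n) :
    (Equiv.Perm (Fin n) → ℝ) →ₗ[ℝ] (Equiv.Perm (Fin n) → ℝ) where
  toFun v g := ∑ i ∈ B, v (swap i k * g)
  map_add' v w := by
    ext g
    simp [Finset.sum_add_distrib]
  map_smul' c v := by
    ext g
    simp [Finset.mul_sum]

theorem swapSum_apply (B : Finset (Fin n)) (k : Fin n) (v : Equiv.Perm (Fin n) → ℝ)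
    (g : Equiv.Perm (Fin n)) : swapSum B k v g = ∑ i ∈ B, v (swap i k * g) := rfl

/-- The action of the Jucys–Murphy element `∑_{i < k} (i k)`. -/
def jucysMurphy (k : Fin n) : (Equiv.Perm (Fin n) → ℝ) →ₗ[ℝ] (Equiv.Perm (Fin n) → ℝ) :=
  swapSum (Finset.Iio k) k

/-- `v` does not change under left multiplication by transpositions of elements of `B`. -/
def SwapInvariantOn (B : Finset (Fin n)) (v : Equiv.Perm (Fin n) → ℝ) : Prop :=
  ∀ i ∈ B, ∀ j ∈ B, ∀ g, v (swap i j * g) = v g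

/-- Conjugation by (a b) fixes `k` and permutes the transpositions (i k) with i ∈ B. -/
theorem swapSum_swap_mul {B : Finset (Fin n)} {k a b : Fin n}
    (h : ∀ i, i ∈ B ↔ swap a b i ∈ B) (ha : a ≠ k) (hb : b ≠ k)
    (v : Equiv.Perm (Fin n) → ℝ) (g : Equiv.Perm (Fin n)) :
    swapSum B k v (swap a b * g) = ∑ i ∈ B, v (swap a b * (swap i k * g)) := by
  rw [swapSum_apply]
  refine Finset.sum_equiv (swap a b) h fun i _ => ?_
  congr 1
  rw [← mul_assoc, ← mul_assoc]
  congr 1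
  have := Equiv.mul_swap_eq_swap_mul (swap a b) (swap a b i) k
  rw [Equiv.swap_apply_self, Equiv.swap_apply_of_ne_of_ne ha.symm hb.symm] at this
  exact this.symm

theorem swap_apply_mem_iff {B : Finset (Fin n)} {a b : Fin n} (h : a ∈ B ↔ b ∈ B) (i : Fin n) :
    i ∈ B ↔ swap a b i ∈ B := by
  rw [Equiv.swap_apply_def]
  split_ifs with h₁ h₂
  · rw [h₁, h]
  · rw [h₂, h]
  · rfl

theorem swapSum_swap_mul_of_invariant {B : Finset (Fin n)} {k a b : Fin n}
    (h : a ∈ B ↔ b ∈ B) (ha : a ≠ k) (hb : b ≠ k)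
    {v : Equiv.Perm (Fin n) → ℝ} (hv : ∀ g, v (swap a b * g) = v g) (g : Equiv.Perm (Fin n)) :
    (v + swapSum B k v) (swap a b * g) = (v + swapSum B k v) g := by
  rw [Pi.add_apply, Pi.add_apply, swapSum_swap_mul (swap_apply_mem_iff h) ha hb, hv g]
  simp only [hv, swapSum_apply]

/-- The identity and the (i k) with i ∈ B represent the cosets of Sym(B) in Sym(B ∪ {k}), so adding
these translates completes the symmetrization. -/
theorem SwapInvariantOn.insert {B : Finset (Fin n)} {k : Fin n} (hk : k ∉ B)
    {v : Equiv.Perm (Fin n) → ℝ} (hv : SwapInvariantOn B v) :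
    SwapInvariantOn (Insert.insert k B) (v + swapSum B k v) := by
  have key : ∀ i ∈ B, ∀ g,
      (v + swapSum B k v) (swap i k * g) = (v + swapSum B k v) g := by
    intro i hi g
    simp only [Pi.add_apply, swapSum_apply]
    rw [← Finset.add_sum_erase _ _ hi, ← Finset.add_sum_erase _ (fun j => v (swap j k * g)) hi,
      ← mul_assoc, Equiv.swap_mul_self, one_mul]
    -- Uses (j k)(i k) = (i j)(j k) and the invariance under (i j).
    have : ∀ j ∈ B.erase i, v (swap j k * (swap i k * g)) = v (swap j k * g) := by
      intro j hj
      obtain ⟨hji, hj⟩ := Finset.mem_erase.1 hj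
      rw [← hv i hi j hj (swap j k * g), ← mul_assoc, ← mul_assoc]
      congr 2
      have := Equiv.mul_swap_eq_swap_mul (swap j k) i k
      rw [Equiv.swap_apply_right, Equiv.swap_apply_of_ne_of_ne hji.symm
        (ne_of_mem_of_not_mem hi hk)] at this
      exact this
    rw [Finset.sum_congr rfl this]
    ring
  intro i hi j hj g
  rw [Finset.mem_insert] at hi hj
  rcases hi with rfl | hi
  · rcases hj with rfl | hj
    · rw [Equiv.swap_self]
      rfl
    · rw [Equiv.swap_comm]
      exact key j hj g
  · rcases hj with rfl | hj
    · exact key i hi g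
    · exact swapSum_swap_mul_of_invariant (iff_of_true hi hj) (ne_of_mem_of_not_mem hi hk)
        (ne_of_mem_of_not_mem hj hk) (hv i hi j hj) g

/-- Every transposition in J_j moves only entries below `k`, so conjugation by it merely permutes
the summands of J_k. -/
theorem jucysMurphy_comm_of_lt {j k : Fin n} (hjk : j < k) (v : Equiv.Perm (Fin n) → ℝ) :
    jucysMurphy j (jucysMurphy k v) = jucysMurphy k (jucysMurphy j v) := by
  ext g
  have h : ∀ i ∈ Finset.Iio j, jucysMurphy k v (swap i j * g) =
      ∑ l ∈ Finset.Iio k, v (swap i j * (swap l k * g)) := by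
    intro i hi
    have hik : i < k := (Finset.mem_Iio.1 hi).trans hjk
    exact swapSum_swap_mul (swap_apply_mem_iff
      (iff_of_true (Finset.mem_Iio.2 hik) (Finset.mem_Iio.2 hjk))) hik.ne hjk.ne v g
  rw [jucysMurphy, swapSum_apply, Finset.sum_congr rfl h, Finset.sum_comm]
  rfl

theorem jucysMurphy_comm (j k : Fin n) (v : Equiv.Perm (Fin n) → ℝ) :
    jucysMurphy j (jucysMurphy k v) = jucysMurphy k (jucysMurphy j v) := by
  rcases lt_trichotomy j k with h | rfl | h
  · exact jucysMurphy_comm_of_lt h v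
  · rfl
  · exact (jucysMurphy_comm_of_lt h v).symm

theorem abs_jucysMurphy_apply_le (k : Fin n) {v : Equiv.Perm (Fin n) → ℝ}
    {g : Equiv.Perm (Fin n)} (hg : ∀ h, |v h| ≤ |v g|) :
    |jucysMurphy k v g| ≤ k * |v g| := by
  rw [jucysMurphy, swapSum_apply]
  refine (Finset.abs_sum_le_sum_abs _ _).trans ((Finset.sum_le_sum fun i _ => hg _).trans ?_)
  rw [Finset.sum_const, Fin.card_Iio, nsmul_eq_mul]

/-- The action of the weighted sum `∑_k w_k J_k` of the Jucys–Murphy elements. -/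
def weightedJucysMurphy (w : ℕ → ℝ) :
    (Equiv.Perm (Fin n) → ℝ) →ₗ[ℝ] (Equiv.Perm (Fin n) → ℝ) :=
  ∑ k : Fin n, w k • jucysMurphy k

theorem weightedJucysMurphy_apply (w : ℕ → ℝ) (v : Equiv.Perm (Fin n) → ℝ)
    (g : Equiv.Perm (Fin n)) :
    weightedJucysMurphy w v g = ∑ k : Fin n, w k * jucysMurphy k v g := by
  simp [weightedJucysMurphy, LinearMap.sum_apply, Finset.sum_apply]

theorem weightedJucysMurphy_jucysMurphy (w : ℕ → ℝ) (k : Fin n)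
    (v : Equiv.Perm (Fin n) → ℝ) :
    weightedJucysMurphy w (jucysMurphy k v) = jucysMurphy k (weightedJucysMurphy w v) := by
  simp only [weightedJucysMurphy, LinearMap.sum_apply, LinearMap.smul_apply, map_sum, map_smul,
    jucysMurphy_comm k]

end SwapSum

/-! ### Row-invariant and column-alternating functions -/

namespace Diagram

variable {n : ℕ} (α : Diagram n)

/-- `v` does not change under left multiplication by transpositions of entries smaller than `k` in
the same row of `α`. -/
def RowInvariant (k : ℕ) (v : Equiv.Perm (Fin n) → ℝ) : Prop :=
  ∀ i j : Fin n, (i : ℕ) < k → (j : ℕ) < k → α.rowIdx i = α.rowIdx j →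
    ∀ g, v (swap i j * g) = v g

/-- `v` changes sign under right multiplication by transpositions of entries in the same column
of `α`. -/
def ColAlternating (v : Equiv.Perm (Fin n) → ℝ) : Prop :=
  ∀ i j : Fin n, i ≠ j → α.colIdx i = α.colIdx j → ∀ g, v (g * swap i j) = -v g

variable {α}

theorem RowInvariant.mono {k l : ℕ} (h : k ≤ l) {v : Equiv.Perm (Fin n) → ℝ}
    (hv : α.RowInvariant l v) : α.RowInvariant k v :=
  fun i j hi hj => hv i j (hi.trans_le h) (hj.trans_le h)

theorem ColAlternating.add {v w : Equiv.Perm (Fin n) → ℝ} (hv : α.ColAlternating v)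
    (hw : α.ColAlternating w) : α.ColAlternating (v + w) := by
  intro i j hij hc g
  rw [Pi.add_apply, Pi.add_apply, hv i j hij hc, hw i j hij hc]
  ring

theorem ColAlternating.swapSum {v : Equiv.Perm (Fin n) → ℝ} (hv : α.ColAlternating v)
    (B : Finset (Fin n)) (k : Fin n) : α.ColAlternating (swapSum B k v) := by
  intro i j hij hc g
  simp only [swapSum_apply, ← mul_assoc, hv i j hij hc, Finset.sum_neg_distrib]

variable (α)

theorem rowIdx_mono {i j : Fin n} (h : i ≤ j) : α.rowIdx i ≤ α.rowIdx j :=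
  α.rowOf_mono h j.2

theorem eq_of_rowIdx_eq_of_colIdx_eq {i j : Fin n} (hr : α.rowIdx i = α.rowIdx j)
    (hc : α.colIdx i = α.colIdx j) : i = j :=
  Fin.ext (α.eq_of_rowOf_eq_of_colOf_eq hr hc)

/-- Columns have room for at most as many entries as fit into the first `s + 1` rows. -/
theorem card_fiber_le {s c : ℕ} {X : Finset (Fin n)} {blk : Fin n → ℕ}
    (hblk : ∀ i ∈ X, blk i ≤ s) (e : Equiv.Perm (Fin n))
    (hinj : ∀ i ∈ X, ∀ j ∈ X, blk i = blk j → α.colIdx (e i) = α.colIdx (e j) → i = j) :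
    (X.filter fun i => α.colIdx (e i) = c).card ≤
      ((Finset.univ.filter fun i => α.rowIdx i ≤ s).filter fun i => α.colIdx i = c).card := by
  -- If column `c` reaches below row `s`, it has a box in each of the first `s + 1` rows, and the
  -- fiber injects into the blocks. Otherwise the whole column lies in those rows, and `e` injects
  -- the fiber into it.
  by_cases h : ∃ i, α.colIdx i = c ∧ s < α.rowIdx i
  · obtain ⟨i, rfl, hi⟩ := h
    have hmem : ∀ t ≤ s, (t, α.colIdx i) ∈ α.1 := fun t ht =>
      α.1.up_left_mem (ht.trans hi.le) le_rfl (α.rowOf_colOf_mem i.2)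
    calc (X.filter fun j => α.colIdx (e j) = α.colIdx i).card
        ≤ (Finset.range (s + 1)).card := by
          refine Finset.card_le_card_of_injOn blk ?_ ?_
          · intro j hj
            exact Finset.mem_coe.2 (Finset.mem_range.2
              (Nat.lt_succ_of_le (hblk j (Finset.mem_filter.1 hj).1)))
          · intro a ha b hb hab
            obtain ⟨ha, ha'⟩ := Finset.mem_filter.1 ha
            obtain ⟨hb, hb'⟩ := Finset.mem_filter.1 hb
            exact hinj a ha b hb hab (ha'.trans hb'.symm)
      _ ≤ _ := by
          refine Finset.card_le_card_of_injOn (fun t => if ht : (t, α.colIdx i) ∈ α.1 then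
            ⟨α.rowStart t + α.colIdx i, α.rowStart_add_lt ht⟩ else i) ?_ ?_
          · intro t ht
            have ht' := Nat.lt_succ_iff.1 (Finset.mem_range.1 ht)
            simp only [dif_pos (hmem t ht'), Finset.coe_filter, Finset.mem_filter,
              Finset.mem_univ, true_and, Set.mem_ofPred_eq]
            exact ⟨(α.rowOf_rowStart_add (hmem t ht')).trans_le ht',
              α.colOf_rowStart_add (hmem t ht')⟩
          · intro a ha b hb hab
            have ha' := hmem a (Nat.lt_succ_iff.1 (Finset.mem_range.1 ha))
            have hb' := hmem b (Nat.lt_succ_iff.1 (Finset.mem_range.1 hb))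
            simp only [dif_pos ha', dif_pos hb', Fin.mk.injEq] at hab
            rw [← α.rowOf_rowStart_add ha', hab, α.rowOf_rowStart_add hb']
  · push Not at h
    refine Finset.card_le_card_of_injOn e ?_ e.injective.injOn
    intro i hi
    obtain ⟨_, hi⟩ := Finset.mem_filter.1 hi
    exact Finset.mem_filter.2 ⟨Finset.mem_filter.2 ⟨Finset.mem_univ _, h _ hi⟩, hi⟩

variable {α}

/-- Since (i j)g = g(g⁻¹i g⁻¹j), the value at (i j)g is both `v g` and `-v g`. -/
theorem ColAlternating.apply_eq_zero {v : Equiv.Perm (Fin n) → ℝ} (hv : α.ColAlternating v)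
    {i j : Fin n} (hij : i ≠ j) {g : Equiv.Perm (Fin n)} (h : v (swap i j * g) = v g)
    (hc : α.colIdx (g⁻¹ i) = α.colIdx (g⁻¹ j)) : v g = 0 := by
  have h' := hv (g⁻¹ i) (g⁻¹ j) (fun h => hij (g⁻¹.injective h)) hc g
  rw [Equiv.mul_swap_eq_swap_mul, Equiv.Perm.inv_def, Equiv.apply_symm_apply, Equiv.apply_symm_apply, h] at h'
  linarith

/-- The first `s + 1` rows of `α` together with one more entry in row `s` do not fit injectively
into the columns of `α`. -/
theorem ColAlternating.eq_zero {v : Equiv.Perm (Fin n) → ℝ} (hv : α.ColAlternating v) {s : ℕ}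
    {k : Fin n} (hs : s < α.rowIdx k)
    (h₁ : ∀ i j, α.rowIdx i = α.rowIdx j → α.rowIdx i < s → ∀ g, v (swap i j * g) = v g)
    (h₂ : SwapInvariantOn (insert k (Finset.univ.filter fun i => α.rowIdx i = s)) v) :
    v = 0 := by
  ext g
  by_contra hne
  set X := Finset.univ.filter fun i => α.rowIdx i ≤ s with hX
  have hkX : k ∉ X := by
    simp only [hX, Finset.mem_filter, Finset.mem_univ, true_and, not_le]
    exact hs
  -- The extra entry `k` is counted as a member of row `s`.
  let blk : Fin n → ℕ := fun i => if i = k then s else α.rowIdx i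
  have hblk : ∀ i ∈ insert k X, blk i ≤ s := by
    intro i hi
    simp only [blk]
    split_ifs with h
    · exact le_rfl
    · exact (Finset.mem_filter.1 (Finset.mem_of_mem_insert_of_ne hi h)).2
  have hmem : ∀ i ∈ insert k X, blk i = s →
      i ∈ insert k (Finset.univ.filter fun i => α.rowIdx i = s) := by
    intro i _ h
    simp only [blk] at h
    split_ifs at h with h'
    · exact h' ▸ Finset.mem_insert_self _ _
    · exact Finset.mem_insert_of_mem (Finset.mem_filter.2 ⟨Finset.mem_univ _, h⟩)
  have hinj : ∀ i ∈ insert k X, ∀ j ∈ insert k X, blk i = blk j →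
      α.colIdx (g⁻¹ i) = α.colIdx (g⁻¹ j) → i = j := by
    intro i hi j hj hij hc
    by_contra hne'
    refine hne (hv.apply_eq_zero hne' ?_ hc)
    rcases (hblk i hi).lt_or_eq with hlt | heq
    · have hi' : i ≠ k := fun h => by simp [blk, h] at hlt
      have hj' : j ≠ k := fun h => by
        rw [hij] at hlt
        simp [blk, h] at hlt
      simp only [blk, if_neg hi', if_neg hj'] at hij hlt
      exact h₁ i j hij hlt g
    · exact h₂ i (hmem i hi heq) j (hmem j hj (hij ▸ heq)) g
  have hcol : ∀ i : Fin n, α.colIdx i ∈ Finset.range n := fun i =>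
    Finset.mem_range.2 ((Nat.sub_le _ _).trans_lt i.2)
  -- If `v g ≠ 0`, no two entries of a block share a column under g⁻¹; summing the column bounds
  -- then contradicts `k ∉ X`.
  have hcard : (insert k X).card ≤ X.card := by
    rw [Finset.card_eq_sum_card_fiberwise (f := fun i => α.colIdx (g⁻¹ i)) (t := Finset.range n)
      (fun i _ => hcol _), Finset.card_eq_sum_card_fiberwise (s := X) (f := fun i => α.colIdx i)
      (t := Finset.range n) (fun i _ => hcol _)]
    exact Finset.sum_le_sum fun c _ => α.card_fiber_le hblk g⁻¹ hinj
  rw [Finset.card_insert_of_notMem hkX] at hcard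
  omega

/-- A Garnir-type relation: symmetrizing over a full higher row together with `k` kills `v`, because
the enlarged row no longer fits into the columns. -/
theorem swapSum_row_eq_neg {k : Fin n} {v : Equiv.Perm (Fin n) → ℝ} (hv : α.ColAlternating v)
    (hr : α.RowInvariant k v) {s : ℕ} (hs : s < α.rowIdx k) :
    swapSum (Finset.univ.filter fun i => α.rowIdx i = s) k v = -v := by
  have hlt : ∀ i, α.rowIdx i ≤ s → i < k := by
    intro i hi
    by_contra! hle
    exact absurd (α.rowIdx_mono hle) (by omega)
  rw [eq_neg_iff_add_eq_zero, add_comm]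
  refine (hv.add (hv.swapSum _ k)).eq_zero hs ?_ ?_
  · intro i j hij hi g
    have hik := hlt i hi.le
    have hjk := hlt j (hij ▸ hi.le)
    refine swapSum_swap_mul_of_invariant ?_ hik.ne hjk.ne (hr i j hik hjk hij) g
    simp only [Finset.mem_filter, Finset.mem_univ, true_and, hij]
  · refine SwapInvariantOn.insert ?_ ?_
    · simp only [Finset.mem_filter, Finset.mem_univ, true_and]
      exact hs.ne'
    · intro i hi j hj
      have hi := (Finset.mem_filter.1 hi).2
      have hj := (Finset.mem_filter.1 hj).2
      exact hr i j (hlt i hi.le) (hlt j hj.le) (hi.trans hj.symm)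

variable (α) in
/-- The entries to the left of `k` in its row. -/
noncomputable def leftOf (k : Fin n) : Finset (Fin n) :=
  (Finset.Iio k).filter fun i => α.rowIdx i = α.rowIdx k

theorem mem_leftOf {i k : Fin n} : i ∈ α.leftOf k ↔ i < k ∧ α.rowIdx i = α.rowIdx k := by
  simp [leftOf]

variable (α) in
theorem card_leftOf (k : Fin n) : (α.leftOf k).card = α.colIdx k := by
  have hk : α.rowStart (α.rowIdx k) ≤ k := α.rowStart_rowOf_le k
  have : α.leftOf k = Finset.Ico ⟨α.rowStart (α.rowIdx k), hk.trans_lt k.2⟩ k := by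
    ext i
    rw [mem_leftOf, Finset.mem_Ico, Fin.le_def, and_comm]
    refine and_congr_left fun hi => ⟨fun h => ?_, fun h => ?_⟩
    · change α.rowStart (α.rowIdx k) ≤ i
      rw [← h]
      exact α.rowStart_rowOf_le i
    · exact α.rowOf_eq h ((Fin.lt_def.1 hi).trans (α.lt_rowStart_rowOf_succ k.2))
  rw [this, Fin.card_Ico]
  rfl

/-- The entries before `k` split by rows. Each of the `rowIdx k` full rows above contributes -1,
leaving the entries to the left of `k`. -/
theorem RowInvariant.jucysMurphy_eq {k : Fin n} {v : Equiv.Perm (Fin n) → ℝ}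
    (hr : α.RowInvariant k v) (hv : α.ColAlternating v) :
    jucysMurphy k v = swapSum (α.leftOf k) k v - (α.rowIdx k : ℝ) • v := by
  ext g
  rw [jucysMurphy, swapSum_apply, ← Finset.sum_fiberwise_of_maps_to (g := α.rowIdx)
    (t := Finset.range (α.rowIdx k + 1)) (fun i hi => Finset.mem_range.2
      (Nat.lt_succ_of_le (α.rowIdx_mono (Finset.mem_Iio.1 hi).le))),
    Finset.sum_range_succ]
  have : ∀ s ∈ Finset.range (α.rowIdx k),
      ∑ i ∈ Finset.Iio k with α.rowIdx i = s, v (swap i k * g) = -v g := by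
    intro s hs
    have hs := Finset.mem_range.1 hs
    have h := congrFun (swapSum_row_eq_neg hv hr hs) g
    rw [swapSum_apply, Pi.neg_apply] at h
    rw [← h]
    refine Finset.sum_congr ?_ fun _ _ => rfl
    ext i
    simp only [Finset.mem_filter, Finset.mem_Iio, Finset.mem_univ, true_and,
      and_iff_right_iff_imp]
    intro hi
    by_contra! hle
    exact absurd (α.rowIdx_mono hle) (by omega)
  rw [Finset.sum_congr rfl this, Finset.sum_const, Finset.card_range]
  simp only [leftOf, swapSum_apply, Pi.sub_apply, Pi.smul_apply, smul_eq_mul, nsmul_eq_mul]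
  ring

/-- Each of the `colIdx k` transpositions in the row of `k` now contributes +1. -/
theorem RowInvariant.jucysMurphy_eq_content {k : Fin n} {v : Equiv.Perm (Fin n) → ℝ}
    (hr : α.RowInvariant (k + 1) v) (hv : α.ColAlternating v) :
    jucysMurphy k v = α.content k • v := by
  rw [(hr.mono (Nat.le_succ _)).jucysMurphy_eq hv]
  have : swapSum (α.leftOf k) k v = (α.colIdx k : ℝ) • v := by
    ext g
    rw [swapSum_apply, Finset.sum_congr rfl fun i hi =>
      hr i k ((Fin.lt_def.1 (mem_leftOf.1 hi).1).trans (Nat.lt_succ_self _)) (Nat.lt_succ_self _)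
        (mem_leftOf.1 hi).2 g, Finset.sum_const, card_leftOf]
    simp
  rw [this, ← sub_smul]
  rfl

theorem RowInvariant.succ {k : Fin n} {v : Equiv.Perm (Fin n) → ℝ}
    (hr : α.RowInvariant k v) : α.RowInvariant (k + 1) (v + swapSum (α.leftOf k) k v) := by
  intro i j hi hj hij g
  have hlt : ∀ i : Fin n, (i : ℕ) < k + 1 → i ≠ k → i < k := fun i hi hne =>
    lt_of_le_of_ne (Fin.le_def.2 (Nat.lt_succ_iff.1 hi)) hne
  by_cases hik : α.rowIdx i = α.rowIdx k
  · have hmem : ∀ i : Fin n, (i : ℕ) < k + 1 → α.rowIdx i = α.rowIdx k →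
        i ∈ insert k (α.leftOf k) := by
      intro i hi hik
      by_cases h : i = k
      · exact h ▸ Finset.mem_insert_self _ _
      · exact Finset.mem_insert_of_mem (mem_leftOf.2 ⟨hlt i hi h, hik⟩)
    refine SwapInvariantOn.insert ?_ ?_ i (hmem i hi hik) j (hmem j hj (hij ▸ hik)) g
    · simp [mem_leftOf]
    · intro a ha b hb
      obtain ⟨ha, ha'⟩ := mem_leftOf.1 ha
      obtain ⟨hb, hb'⟩ := mem_leftOf.1 hb
      exact hr a b ha hb (ha'.trans hb'.symm)
  · have hi' : i ≠ k := fun h => hik (h ▸ rfl)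
    have hj' : j ≠ k := fun h => hik (hij.trans (h ▸ rfl))
    refine swapSum_swap_mul_of_invariant ?_ hi' hj'
      (hr i j (hlt i hi hi') (hlt j hj hj') hij) g
    refine iff_of_false (fun h => hik (mem_leftOf.1 h).2) fun h => hik ?_
    exact hij.trans (mem_leftOf.1 h).2

/-! ### Bounding the eigenvalues on column-alternating functions -/

theorem weightedJucysMurphy_of_rowInvariant (w : ℕ → ℝ) {v : Equiv.Perm (Fin n) → ℝ}
    (hr : α.RowInvariant n v) (hv : α.ColAlternating v) :
    weightedJucysMurphy w v = (∑ j ∈ Finset.range n, w j * α.content j) • v := by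
  ext g
  rw [weightedJucysMurphy_apply, Pi.smul_apply, smul_eq_mul, Finset.sum_mul, Finset.sum_range]
  refine Finset.sum_congr rfl fun k _ => ?_
  rw [(hr.mono k.2).jucysMurphy_eq_content hv, Pi.smul_apply, smul_eq_mul, mul_assoc]

/-- Here `v` need not be an eigenvector of the later J_j. Evaluating where |v| is maximal gives
quotients J_j v / v of size at most `j`, which suffices for the lexicographic comparison. At `k` the
quotient is -1 - row, at least 1 below the content. -/
theorem eigenvalue_lt_of_deviation {k : Fin n} {μ : ℝ} {v : Equiv.Perm (Fin n) → ℝ} (hv0 : v ≠ 0)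
    (hr : α.RowInvariant k v) (hv : α.ColAlternating v)
    (hk : jucysMurphy k v = (-1 - α.rowIdx k : ℝ) • v)
    (hμ : weightedJucysMurphy (fun j => fastWeights n (j + 1)) v = μ • v) :
    μ < ∑ j ∈ Finset.range n, fastWeights n (j + 1) * α.content j := by
  obtain ⟨g, hg⟩ := Finite.exists_max fun g => |v g|
  have hg0 : v g ≠ 0 := by
    intro h0
    refine hv0 (funext fun h => ?_)
    have := hg h
    rw [h0, abs_zero] at this
    exact abs_nonpos_iff.1 this
  let x : ℕ → ℝ := fun j => if h : j < n then jucysMurphy ⟨j, h⟩ v g / v g else 0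
  have hxj : ∀ j : Fin n, x j = jucysMurphy j v g / v g := fun j => dif_pos j.2
  have hsum : μ = ∑ j ∈ Finset.range n, fastWeights n (j + 1) * x j := by
    have h := congrFun hμ g
    rw [weightedJucysMurphy_apply, Pi.smul_apply, smul_eq_mul] at h
    rw [eq_div_of_mul_eq hg0 h.symm, Finset.sum_range, Finset.sum_div]
    exact Finset.sum_congr rfl fun j _ => by rw [hxj, mul_div_assoc]
  rw [hsum]
  refine sum_fastWeights_lt k.2 ?_ (fun j hj => α.abs_content_le hj) ?_ ?_
  · intro j hj
    have := abs_jucysMurphy_apply_le ⟨j, hj⟩ hg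
    rw [hxj ⟨j, hj⟩, abs_div]
    exact div_le_of_le_mul₀ (abs_nonneg _) (Nat.cast_nonneg _) this
  · intro j hj
    have h : jucysMurphy ⟨j, hj.trans k.2⟩ v = α.content j • v :=
      (hr.mono (Nat.succ_le_of_lt hj)).jucysMurphy_eq_content hv
    rw [hxj ⟨j, hj.trans k.2⟩, h, Pi.smul_apply, smul_eq_mul, mul_div_cancel_right₀ _ hg0]
  · rw [hxj, hk, Pi.smul_apply, smul_eq_mul, mul_div_cancel_right₀ _ hg0, content,
      ← colIdx_eq_colOf, ← rowIdx_eq_rowOf]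
    have : (0 : ℝ) ≤ α.colIdx k := Nat.cast_nonneg _
    linarith

/-- Symmetrization at the next entry acts on `u` as J_k + (1 + row), which commutes with the
weighted sum. The result is thus a new eigenvector for μ, or zero, in which case J_k deviates from
the content. -/
theorem exists_rowInvariant_or_lt {μ : ℝ} {v : Equiv.Perm (Fin n) → ℝ} (hv0 : v ≠ 0)
    (hv : α.ColAlternating v)
    (hμ : weightedJucysMurphy (fun j => fastWeights n (j + 1)) v = μ • v) (k : ℕ) (hk : k ≤ n) :
    (∃ u : Equiv.Perm (Fin n) → ℝ, u ≠ 0 ∧ α.ColAlternating u ∧ α.RowInvariant k u ∧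
      weightedJucysMurphy (fun j => fastWeights n (j + 1)) u = μ • u) ∨
    μ < ∑ j ∈ Finset.range n, fastWeights n (j + 1) * α.content j := by
  induction k with
  | zero => exact Or.inl ⟨v, hv0, hv, fun i j hi => absurd hi (Nat.not_lt_zero _), hμ⟩
  | succ k ih =>
    rcases ih (by omega) with ⟨u, hu0, hu, hr, hμ⟩ | h
    · have hr : α.RowInvariant ((⟨k, hk⟩ : Fin n) : ℕ) u := hr
      have hJ := hr.jucysMurphy_eq hu
      set κ : Fin n := ⟨k, hk⟩
      by_cases h0 : u + swapSum (α.leftOf κ) κ u = 0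
      · right
        refine eigenvalue_lt_of_deviation hu0 hr hu ?_ hμ
        rw [hJ, eq_neg_of_add_eq_zero_right h0, sub_smul, neg_smul, one_smul]
      · left
        refine ⟨_, h0, hu.add (hu.swapSum _ _), hr.succ, ?_⟩
        have h : u + swapSum (α.leftOf κ) κ u =
            jucysMurphy κ u + (1 + α.rowIdx κ : ℝ) • u := by
          rw [hJ, add_smul, one_smul]
          abel
        rw [h, map_add, map_smul, weightedJucysMurphy_jucysMurphy, hμ, map_smul, smul_add,
          smul_comm]
    · exact Or.inr h

/-- On column-alternating functions, the content sum of the reading order bounds all eigenvalues of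
the weighted sum of the Jucys–Murphy elements. -/
theorem eigenvalue_le {μ : ℝ} {v : Equiv.Perm (Fin n) → ℝ} (hv0 : v ≠ 0)
    (hv : α.ColAlternating v)
    (hμ : weightedJucysMurphy (fun j => fastWeights n (j + 1)) v = μ • v) :
    μ ≤ ∑ j ∈ Finset.range n, fastWeights n (j + 1) * α.content j := by
  rcases exists_rowInvariant_or_lt hv0 hv hμ n le_rfl with ⟨u, hu0, hu, hr, hμ⟩ | h
  · rw [weightedJucysMurphy_of_rowInvariant (fun j => fastWeights n (j + 1)) hr hu] at hμ
    exact (smul_left_injective ℝ hu0 hμ).ge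
  · exact h.le

end Diagram

/-! ### From the group ring to functions -/

section GroupRing

variable {n : ℕ}

theorem coeff_laplacian_mul (A : Matrix (Fin n) (Fin n) ℝ)
    (x : MonoidAlgebra ℝ (Equiv.Perm (Fin n))) (g : Equiv.Perm (Fin n)) :
    (laplacian A * x).coeff g =
      ∑ i : Fin n, ∑ j : Fin n with i < j, A i j * (x.coeff g - x.coeff (swap i j * g)) := by
  simp [laplacian, Finset.sum_mul, sub_mul, ← MonoidAlgebra.one_def]

/-- An edge lies only in the star centred at its larger endpoint; the entry `j`, counted from 0, is
vertex `j + 1`. -/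
theorem quasiComplete_apply (a : ℕ → ℝ) {i j : Fin n} (hij : i < j) :
    quasiComplete n a i j = a (j + 1) := by
  have hj : 0 < (j : ℕ) := (Nat.zero_le _).trans_lt (Fin.lt_def.1 hij)
  have hlt := Fin.lt_def.1 hij
  have hn := j.2
  rw [quasiComplete, Matrix.sum_apply, Finset.sum_eq_single ((j : ℕ) + 1)]
  · simp [starGraph, completeOn, hij.ne, hlt.trans (Nat.lt_succ_self _)]
  · intro k hk hne
    have : (i : ℕ) < k ∧ (j : ℕ) < k ↔ (i : ℕ) < k - 1 ∧ (j : ℕ) < k - 1 := by omega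
    simp only [starGraph, completeOn, Matrix.smul_apply, Matrix.sub_apply, this, sub_self,
      smul_zero]
  · intro h
    exact absurd (Finset.mem_Icc.2 ⟨by omega, by omega⟩) h

theorem quasiComplete_nonneg {a : ℕ → ℝ} (ha : ∀ k, 0 ≤ a k) (i j : Fin n) :
    0 ≤ quasiComplete n a i j := by
  rw [quasiComplete, Matrix.sum_apply]
  refine Finset.sum_nonneg fun k _ => mul_nonneg (ha k) ?_
  simp only [starGraph, completeOn, Matrix.sub_apply]
  split_ifs with h₁ h₂ h₂
  · simp
  · simp
  · exact absurd ⟨h₂.1, by omega, by omega⟩ h₁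
  · simp

theorem coeff_laplacian_quasiComplete_mul (a : ℕ → ℝ)
    (x : MonoidAlgebra ℝ (Equiv.Perm (Fin n))) (g : Equiv.Perm (Fin n)) :
    (laplacian (quasiComplete n a) * x).coeff g = totalWeight (quasiComplete n a) * x.coeff g -
      weightedJucysMurphy (fun j => a (j + 1)) x.coeff g := by
  have h : weightedJucysMurphy (fun j => a (j + 1)) x.coeff g =
      ∑ i : Fin n, ∑ j : Fin n with i < j, quasiComplete n a i j * x.coeff (swap i j * g) := by
    rw [weightedJucysMurphy_apply]
    simp only [Finset.sum_filter]
    rw [Finset.sum_comm]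
    refine Finset.sum_congr rfl fun j _ => ?_
    rw [jucysMurphy, swapSum_apply, Finset.mul_sum, ← Finset.sum_filter]
    refine Finset.sum_congr (by ext; simp) fun i hi => ?_
    rw [quasiComplete_apply a (Finset.mem_filter.1 hi).2]
  rw [coeff_laplacian_mul, h, totalWeight]
  simp only [mul_sub, Finset.sum_sub_distrib, Finset.sum_mul]

end GroupRing

/-! ### The Young symmetrizer and its ideal -/

namespace Diagram

variable {n : ℕ} (α : Diagram n)

theorem coeff_colSum (g : Equiv.Perm (Fin n)) : α.colSum.coeff g =
    if ∀ i, α.colIdx (g i) = α.colIdx i then ((Equiv.Perm.sign g : ℤ) : ℝ) else 0 := by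
  classical
  simp [colSum, MonoidAlgebra.coeff_sum, Finsupp.single_apply]

theorem coeff_rowSum (g : Equiv.Perm (Fin n)) : α.rowSum.coeff g =
    if ∀ i, α.rowIdx (g i) = α.rowIdx i then 1 else 0 := by
  classical
  simp [rowSum, MonoidAlgebra.coeff_sum, Finsupp.single_apply]

variable {α} in
theorem apply_swap_eq {f : Fin n → ℕ} {i j : Fin n} (h : f i = f j) (l : Fin n) :
    f (swap i j l) = f l := by
  rw [Equiv.swap_apply_def]
  split_ifs with h₁ h₂
  · rw [h₁, h]
  · rw [h₂, h]
  · rfl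

theorem colSum_mul_single {i j : Fin n} (hij : i ≠ j) (h : α.colIdx i = α.colIdx j) :
    α.colSum * MonoidAlgebra.single (swap i j) 1 = -α.colSum := by
  ext g
  have : (∀ l, α.colIdx ((g * swap i j) l) = α.colIdx l) ↔
      ∀ l, α.colIdx (g l) = α.colIdx l := by
    rw [← (swap i j).forall_congr_right]
    simp [apply_swap_eq h]
  rw [MonoidAlgebra.coeff_mul_single_apply, Equiv.swap_inv, coeff_colSum]
  simp only [this, Equiv.Perm.sign_mul, Equiv.Perm.sign_swap hij, MonoidAlgebra.coeff_neg,
    Finsupp.neg_apply, coeff_colSum]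
  split_ifs <;> simp

theorem single_mul_rowSum {i j : Fin n} (h : α.rowIdx i = α.rowIdx j) :
    MonoidAlgebra.single (swap i j) 1 * α.rowSum = α.rowSum := by
  ext g
  rw [MonoidAlgebra.coeff_single_mul_apply, Equiv.swap_inv, coeff_rowSum, coeff_rowSum]
  simp [apply_swap_eq h]

/-- Right multiplication by a column transposition negates the symmetrizer and commutes with the
left multiplications that generate the ideal. -/
theorem colAlternating_of_mem {x : MonoidAlgebra ℝ (Equiv.Perm (Fin n))}
    (hx : x ∈ α.spechtIdeal) : α.ColAlternating x.coeff := by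
  obtain ⟨y, rfl⟩ := Submodule.mem_span_singleton.1 hx
  intro i j hij h g
  have : y • α.youngSymmetrizer * MonoidAlgebra.single (swap i j) 1 =
      -(y • α.youngSymmetrizer) := by
    rw [smul_eq_mul, youngSymmetrizer, ← mul_assoc, mul_assoc, α.colSum_mul_single hij h, mul_neg]
  have := congrArg (fun x => x.coeff g) this
  simpa using this

theorem rowInvariant_youngSymmetrizer : α.RowInvariant n α.youngSymmetrizer.coeff := by
  intro i j _ _ h g
  have : MonoidAlgebra.single (swap i j) 1 * α.youngSymmetrizer = α.youngSymmetrizer := by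
    rw [youngSymmetrizer, ← mul_assoc, α.single_mul_rowSum h]
  have := congrArg (fun x => x.coeff g) this
  simpa using this

theorem youngSymmetrizer_mem : α.youngSymmetrizer ∈ α.spechtIdeal :=
  Submodule.mem_span_singleton_self _

/-- Only the identity preserves both rows and columns. In particular the symmetrizer is nonzero,
hence an eigenvector. -/
theorem coeff_youngSymmetrizer_one : α.youngSymmetrizer.coeff 1 = 1 := by
  rw [youngSymmetrizer, rowSum, Finset.sum_mul, MonoidAlgebra.coeff_sum, Finsupp.finsetSum_apply,
    Finset.sum_eq_single 1]
  · simp [coeff_colSum]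
  · intro h hh hne
    rw [MonoidAlgebra.coeff_single_mul_apply, one_mul, mul_one, coeff_colSum, if_neg]
    intro hc
    refine hne (Equiv.ext fun i => α.eq_of_rowIdx_eq_of_colIdx_eq
      ((Finset.mem_filter.1 hh).2 i) ?_)
    have := hc (h i)
    rw [Equiv.Perm.inv_def, Equiv.symm_apply_apply] at this
    exact this.symm
  · intro h
    simp at h

theorem asAlgebraHom_irrep_apply (z : MonoidAlgebra ℝ (Equiv.Perm (Fin n)))
    (x : α.spechtIdeal) :
    ((α.irrep.asAlgebraHom z x : α.spechtIdeal) : MonoidAlgebra ℝ (Equiv.Perm (Fin n))) =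
      z * x := by
  rw [Representation.asAlgebraHom_def, irrep, Representation.ofModule', Equiv.apply_symm_apply]
  rfl

theorem mem_eigenvalueSet_iff (a : ℕ → ℝ) (μ : ℝ) :
    μ ∈ eigenvalueSet (quasiComplete n a) α.irrep ↔ ∃ x ∈ α.spechtIdeal, x ≠ 0 ∧
      weightedJucysMurphy (fun j => a (j + 1)) x.coeff =
        (totalWeight (quasiComplete n a) - μ) • ⇑x.coeff := by
  have key : ∀ x : MonoidAlgebra ℝ (Equiv.Perm (Fin n)),
      laplacian (quasiComplete n a) * x = μ • x ↔
        weightedJucysMurphy (fun j => a (j + 1)) x.coeff =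
          (totalWeight (quasiComplete n a) - μ) • ⇑x.coeff := by
    intro x
    rw [MonoidAlgebra.ext_iff, Finsupp.ext_iff, funext_iff]
    refine forall_congr' fun g => ?_
    rw [coeff_laplacian_quasiComplete_mul]
    simp only [MonoidAlgebra.coeff_smul, Finsupp.smul_apply, Pi.smul_apply, smul_eq_mul, sub_mul]
    constructor <;> intro h <;> linarith
  constructor
  · intro h
    obtain ⟨⟨x, hx⟩, h, h0⟩ := h.exists_hasEigenvector
    refine ⟨x, hx, fun h => h0 (Subtype.ext h), (key x).1 ?_⟩
    rw [Module.End.mem_eigenspace_iff] at h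
    rw [← α.asAlgebraHom_irrep_apply _ ⟨x, hx⟩, h]
    rfl
  · rintro ⟨x, hx, h0, h⟩
    refine Module.End.hasEigenvalue_of_hasEigenvector (x := ⟨x, hx⟩)
      ⟨Module.End.mem_eigenspace_iff.2 (Subtype.ext ?_), fun h => h0 (congrArg Subtype.val h)⟩
    rw [asAlgebraHom_irrep_apply]
    exact (key x).2 h

end Diagram

/-- Box 1 is the corner, of content 0, so the sum may start at weight a_1 and match the Jucys–Murphy
indexing from 0. -/
theorem RemovalSequence.eigenvalue_eq {n : ℕ} {α : Diagram n} (S : RemovalSequence α)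
    (a : ℕ → ℝ) : S.eigenvalue a = totalWeight (quasiComplete n a) -
      ∑ j ∈ Finset.range n, a (j + 1) * (((S.box (j + 1)).2 : ℝ) - ((S.box (j + 1)).1 : ℝ)) := by
  rw [RemovalSequence.eigenvalue]
  congr 1
  rcases Nat.eq_zero_or_pos n with rfl | hn
  · simp
  have h0 : ((S.box (0 + 1)).2 : ℝ) - ((S.box (0 + 1)).1 : ℝ) = 0 := by
    have := S.abs_content_box_le hn
    rw [Nat.cast_zero] at this
    exact abs_nonpos_iff.1 this
  obtain ⟨m, rfl⟩ := Nat.exists_eq_add_of_le' hn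
  rw [Finset.sum_range_succ', h0, mul_zero, add_zero]
  refine (Finset.sum_bij (fun j _ => j + 2) ?_ ?_ ?_ ?_).symm
  · intro j hj
    have := Finset.mem_range.1 hj
    exact Finset.mem_Icc.2 ⟨by omega, by omega⟩
  · intro i _ j _ h
    omega
  · intro k hk
    have := Finset.mem_Icc.1 hk
    exact ⟨k - 2, Finset.mem_range.2 (by omega), by omega⟩
  · intro j _
    rfl

/-! ### Smallest eigenvalue and the Aldous order -/

namespace Diagram

variable {n : ℕ} (α : Diagram n)

theorem eigenvalue_rowByRow (a : ℕ → ℝ) :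
    α.rowByRow.eigenvalue a = totalWeight (quasiComplete n a) -
      ∑ j ∈ Finset.range n, a (j + 1) * α.content j :=
  α.rowByRow.eigenvalue_eq a

theorem eigenvalue_rowByRow_le (T : RemovalSequence α) :
    α.rowByRow.eigenvalue (fastWeights n) ≤ T.eigenvalue (fastWeights n) := by
  rw [eigenvalue_rowByRow, T.eigenvalue_eq]
  refine sub_le_sub_left ?_ _
  by_cases h : ∀ j < n, T.box (j + 1) = (α.rowOf j, α.colOf j)
  · refine (Finset.sum_congr rfl fun j hj => ?_).le
    rw [h j (Finset.mem_range.1 hj), content]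
  · have hex : ∃ k, k < n ∧ T.box (k + 1) ≠ (α.rowOf k, α.colOf k) := by
      push Not at h
      exact h
    classical
    obtain ⟨hk, hne⟩ := Nat.find_spec hex
    have heq : ∀ j < Nat.find hex, T.box (j + 1) = (α.rowOf j, α.colOf j) := by
      intro j hj
      by_contra hne'
      exact Nat.find_min hex hj ⟨hj.trans hk, hne'⟩
    refine (sum_fastWeights_lt (x := fun j => ((T.box (j + 1)).2 : ℝ) - ((T.box (j + 1)).1 : ℝ))
      hk (fun j hj => T.abs_content_box_le hj)
      (fun j hj => α.abs_content_le hj) (fun j hj => ?_)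
      (T.content_box_lt_of_forall_eq hk heq hne)).le
    rw [heq j hj, content]

theorem isLeast_eigenvalueSet :
    IsLeast (eigenvalueSet (quasiComplete n (fastWeights n)) α.irrep)
      (α.rowByRow.eigenvalue (fastWeights n)) := by
  rw [eigenvalue_rowByRow]
  constructor
  · rw [mem_eigenvalueSet_iff, sub_sub_cancel]
    refine ⟨_, α.youngSymmetrizer_mem, fun h => ?_,
      weightedJucysMurphy_of_rowInvariant (fun j => fastWeights n (j + 1))
        α.rowInvariant_youngSymmetrizer (α.colAlternating_of_mem α.youngSymmetrizer_mem)⟩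
    have := α.coeff_youngSymmetrizer_one
    rw [h] at this
    simp at this
  · intro μ hμ
    obtain ⟨x, hx, h0, h⟩ := (α.mem_eigenvalueSet_iff _ _).1 hμ
    have hc : (⇑x.coeff : Equiv.Perm (Fin n) → ℝ) ≠ 0 := fun h =>
      h0 (MonoidAlgebra.ext (Finsupp.ext fun g => congrFun h g))
    have := eigenvalue_le hc (α.colAlternating_of_mem hx) h
    linarith

theorem lambda1_quasiComplete :
    lambda1 (quasiComplete n (fastWeights n)) α.irrep =
      α.rowByRow.eigenvalue (fastWeights n) :=
  α.isLeast_eigenvalueSet.csInf_eq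

variable {α} in
theorem LexLT.lambda1_lt {β : Diagram n} (h : α.LexLT β) :
    lambda1 (quasiComplete n (fastWeights n)) β.irrep <
      lambda1 (quasiComplete n (fastWeights n)) α.irrep := by
  rw [lambda1_quasiComplete, lambda1_quasiComplete, eigenvalue_rowByRow, eigenvalue_rowByRow]
  obtain ⟨k, hk, heq, hlt⟩ := h.exists_content_lt
  exact sub_lt_sub_left (sum_fastWeights_lt hk (fun j hj => α.abs_content_le hj)
    (fun j hj => β.abs_content_le hj) heq hlt) _

variable {α} in
theorem LexLT.not_aldousLE {β : Diagram n} (h : α.LexLT β) : ¬ β.AldousLE α := fun h' =>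
  absurd (h' _ (quasiComplete_nonneg fun k => by unfold fastWeights; positivity))
    (not_le.2 h.lambda1_lt)

end Diagram

theorem mainTheorem6 (n : ℕ) :
    (∀ α : Diagram n, ∃ S : RemovalSequence α, S.IsRowByRow ∧
      (∀ T : RemovalSequence α, S.eigenvalue (fastWeights n) ≤ T.eigenvalue (fastWeights n)) ∧
      IsLeast (eigenvalueSet (quasiComplete n (fastWeights n)) α.irrep)
        (S.eigenvalue (fastWeights n))) ∧
    (∀ α β : Diagram n, α.LexLT β →
      lambda1 (quasiComplete n (fastWeights n)) β.irrep <
        lambda1 (quasiComplete n (fastWeights n)) α.irrep) ∧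
    (∀ α β : Diagram n, α.LexLT β → ¬ β.AldousLT α) ∧
    (∀ α β : Diagram n, α.AldousLE β → β.AldousLE α → α = β) := by
  refine ⟨fun α => ⟨α.rowByRow, α.rowByRow_isRowByRow, α.eigenvalue_rowByRow_le,
    α.isLeast_eigenvalueSet⟩, fun α β h => h.lambda1_lt, fun α β h h' => h.not_aldousLE h'.1,
    fun α β h h' => ?_⟩
  -- Totality of the lexicographic order: if the diagrams differ, one of the two Aldous inequalities
  -- fails on this graph.
  rcases lt_trichotomy (toLex α.1.rowLen) (toLex β.1.rowLen) with hlt | heq | hlt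
  · exact absurd h' (Diagram.LexLT.not_aldousLE hlt)
  · exact Diagram.rowLen_injective (toLex.injective heq)
  · exact absurd h (Diagram.LexLT.not_aldousLE hlt)
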